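/- Let $n\ge 0$ and let $q:\{1,\dots,n\}^2\to\mathbb T$ satisfy $q(i,i)=1$ and $q(i,j)=\overline{q(j,i)}$. An $n$-tuple of bounded operators $(T_1,\dots,T_n)$ on a complex Hilbert space is called $q$-commuting if $T_iT_j=q(i,j)T_jT_i$ for all $i,j$, and doubly $q$-commuting if moreover $T_iT_j^*=\overline{q(i,j)}\,T_j^*T_i$ for all $i\ne j$. For $F=\{k_1<\dots<k_r\}\subset\{1,\dots,n\}$ put $T_F=T_{k_1}\cdots T_{k_r}$ (with $T_\emptyset=I$) and $T_F^*=T_{k_r}^*\cdots T_{k_1}^*$. For a finite set $G$ and a Hilbert space $\mathcal E$, let $H^2_{\mathcal E}(\mathbb D^{|G|})$ be the Hardy space of power series $\sum_{k\in\mathbb Z_+^{G}}a_kz^k$ with $a_k\in\mathcal E$ and $\sum_k\|a_k\|^2<\infty$ (for $G=\emptyset$ this is $\mathcal E$). Fix square roots $q(i,j)^{1/2}\in\mathbb T$ such that $q(i,i)^{1/2}=1$ and $q(j,i)^{1/2}=\overline{q(i,j)^{1/2}}$ for all $i,j$ (such a choice always exists). For $G\subset\{1,\dots,n\}$ and $m\in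 G$ the rotational shift on $H^2_{\mathcal E}(\mathbb D^{|G|})$, with variables $z=(z_i)_{i\in G}$, is $M_{z_m}R_{[q]_m}$, where $(M_{z_m}f)(z)=z_mf(z)$ and $(R_{[q]_m}f)(z)=f\big((q(m,i)^{1/2}z_i)_{i\in G}\big)$. **Theorem.** Let $T=(T_1,\dots,T_n)$ be a $q$-commuting tuple of contractions on a complex Hilbert space $\mathcal H$ satisfying Brehmer positivity, that is, $$\sum_{F\subset G}(-1)^{|F|}T_FT_F^*\ge 0\qquad\text{for all }G\subset\{1,\dots,n\}.$$ Then for each $G\subset\{1,\dots,n\}$ there exist a Hilbert space $\mathcal H_G$ and doubly $q$-commuting isometries $V_{G,1},\dots,V_{G,n}$ on $H^2_{\mathcal H_G}(\mathbb D^{|G|})$, and there exists an isometry $\Pi:\mathcal H\to\bigoplus_{G}H^2_{\mathcal H_G}(\mathbb D^{|G|})$, such that $$\Pi T_j^*=\Big(\bigoplus_{G}V_{G,j}^*\Big)\Pi\qquad(1\le j\le n).$$ Moreover, for $i\in G$ the operator $V_{G,i}$ is the rotational shift $M_{z_i}R_{[q]_i}$ on $H^2_{\mathcal H_G}(\mathbb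 D^{|G|})$, and for $j\notin G$ the operator $V_{G,j}$ is unitary. -/

import Mathlib

open scoped ComplexConjugate

universe u

noncomputable section

namespace QComm

/-! ## q-commuting tuples and Brehmer positivity -/

section Tuples

variable {n : ℕ} {H : Type*} [NormedAddCommGroup H] [InnerProductSpace ℂ H] [CompleteSpace H]

/-- The standing assumption on `q : {1,…,n}² → 𝕋`: `q(i,i) = 1` and `q(i,j)` is the complex
conjugate of `q(j,i)`. -/
structure IsCommutationFactor (q : Fin n → Fin n → Circle) : Prop where
  diag : ∀ i, q i i = 1
  conj_symm : ∀ i j, (q i j : ℂ) = conj (q j i : ℂ)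

/-- `T` is `q`-commuting: `T_i T_j = q(i,j) T_j T_i` for all `i, j`. -/
def IsQCommuting (q : Fin n → Fin n → Circle) (T : Fin n → H →L[ℂ] H) : Prop :=
  ∀ i j, T i ∘L T j = (q i j : ℂ) • (T j ∘L T i)

/-- `T` is doubly `q`-commuting: it is `q`-commuting and
`T_i T_j^* = conj (q(i,j)) T_j^* T_i` for all `i ≠ j`.
(For `i = j` the second relation would say that `T_i` is normal.) -/
def IsDoublyQCommuting (q : Fin n → Fin n → Circle) (T : Fin n → H →L[ℂ] H) : Prop :=
  IsQCommuting q T ∧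
    ∀ i j, i ≠ j → T i ∘L ContinuousLinearMap.adjoint (T j)
      = conj (q i j : ℂ) • (ContinuousLinearMap.adjoint (T j) ∘L T i)

/-- `T_F = T_{k_1} ⋯ T_{k_r}` for `F = {k_1 < ⋯ < k_r}`; it is the identity for `F = ∅`. -/
def tupleProd (T : Fin n → H →L[ℂ] H) (F : Finset (Fin n)) : H →L[ℂ] H :=
  ((F.sort (· ≤ ·)).map T).prod

/-- `∑_{F ⊆ G} (-1)^{|F|} T_F T_F^*`, where `T_F^* = T_{k_r}^* ⋯ T_{k_1}^*` is the adjoint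
of `T_F`. -/
def szegoSum (T : Fin n → H →L[ℂ] H) (G : Finset (Fin n)) : H →L[ℂ] H :=
  ∑ F ∈ G.powerset,
    (-1 : ℂ) ^ F.card • (tupleProd T F ∘L ContinuousLinearMap.adjoint (tupleProd T F))

/-- Brehmer positivity: `∑_{F ⊆ G} (-1)^{|F|} T_F T_F^* ≥ 0` for all `G ⊆ {1,…,n}`. -/
def BrehmerPositive (T : Fin n → H →L[ℂ] H) : Prop :=
  ∀ G : Finset (Fin n), (szegoSum T G).IsPositive

/-- The class of `n`-tuples of `q`-commuting contractions satisfying Brehmer positivity. -/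
structure IsBrehmerTuple (q : Fin n → Fin n → Circle) (T : Fin n → H →L[ℂ] H) : Prop where
  contraction : ∀ i, ‖T i‖ ≤ 1
  qcomm : IsQCommuting q T
  brehmer : BrehmerPositive T

/-- A choice of square roots `s(i,j) = q(i,j)^{1/2}` with `s(i,i) = 1` and `s(j,i)` the complex
conjugate of `s(i,j)`. -/
structure IsSqrtChoice (q s : Fin n → Fin n → Circle) : Prop where
  sq : ∀ i j, s i j ^ 2 = q i j
  diag : ∀ i, s i i = 1
  conj_symm : ∀ i j, (s i j : ℂ) = conj (s j i : ℂ)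

/-- Such choices of square roots exist for every `q`. -/
theorem exists_isSqrtChoice {q : Fin n → Fin n → Circle} (hq : IsCommutationFactor q) :
    ∃ s, IsSqrtChoice q s := by
  have hr : ∀ z : Circle, ∃ w : Circle, w ^ 2 = z := fun z =>
    ⟨Circle.exp (Complex.arg z / 2), by
      rw [pow_two, ← Circle.exp_add, add_halves, Circle.exp_arg]⟩
  choose r hr using hr
  have hq' : ∀ i j, q i j = (q j i)⁻¹ := fun i j => by
    apply Circle.ext
    rw [hq.conj_symm, Circle.coe_inv_eq_conj]
  refine ⟨fun i j => if i < j then r (q i j) else if j < i then (r (q j i))⁻¹ else 1,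
    fun i j => ?_, fun i => ?_, fun i j => ?_⟩
  · rcases lt_trichotomy i j with h | rfl | h
    · simp [h, hr]
    · simp [hq.diag]
    · simp [h, h.not_gt, hr, hq' i j]
  · simp
  · rcases lt_trichotomy i j with h | rfl | h
    · simp only [h, h.not_gt, if_true, if_false, Circle.coe_inv_eq_conj, Complex.conj_conj]
    · simp
    · simp only [h, h.not_gt, if_true, if_false, Circle.coe_inv_eq_conj]

end Tuples

/-! ## Vector-valued Hardy spaces on polydiscs -/

section Hardy

/-- The `E`-valued Hardy space `H²_E(𝔻^ι)` on the polydisc with coordinates indexed by the finite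
type `ι`: the power series `∑_k a_k z^k`, `k ∈ ℤ₊^ι`, with `a_k ∈ E` and `∑_k ‖a_k‖² < ∞`, normed by
`(∑_k ‖a_k‖²)^{1/2}`. The series is represented by its family of coefficients; its value at a point
of the polydisc is `Hardy.eval`. -/
abbrev Hardy (ι : Type*) (E : Type*) [NormedAddCommGroup E] : Type _ :=
  lp (fun _ : ι → ℕ => E) 2

variable {ι : Type*} {E : Type*} [NormedAddCommGroup E]

theorem Hardy.memℓp_iff (f : (ι → ℕ) → E) :
    Memℓp f 2 ↔ Summable fun k => ‖f k‖ ^ 2 := by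
  rw [memℓp_gen_iff (by norm_num)]
  simp

theorem Hardy.summable_sq (f : Hardy ι E) : Summable fun k => ‖f k‖ ^ 2 :=
  (Hardy.memℓp_iff _).1 (lp.memℓp f)

theorem Hardy.norm_sq (f : Hardy ι E) : ‖f‖ ^ 2 = ∑' k, ‖f k‖ ^ 2 := by
  have := lp.norm_rpow_eq_tsum (p := 2) (by norm_num) f
  simpa using this

theorem Hardy.shift_inj [DecidableEq ι] (m : ι) :
    Function.Injective (fun k : ι → ℕ => k + Pi.single m 1) := add_left_injective _

theorem Hardy.shift_support [DecidableEq ι] (m : ι) (k : ι → ℕ)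
    (h : k ∉ Set.range (fun k : ι → ℕ => k + Pi.single m 1)) : k m = 0 := by
  by_contra h0
  refine h ⟨k - Pi.single m 1, ?_⟩
  ext i
  by_cases hi : i = m
  · subst hi; simp; omega
  · simp [hi]

variable [Fintype ι] [InnerProductSpace ℂ E]

/-- The value `f(z) = ∑_k z^k a_k`. -/
def Hardy.eval (f : Hardy ι E) (z : ι → ℂ) : E :=
  ∑' k : ι → ℕ, (∏ i, z i ^ k i) • f k

/-- The rotation `R_c f(z) = f(c z)`, that is `∑ a_k z^k ↦ ∑ a_k c^k z^k`, where
`c ∈ 𝕋^ι`. -/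
def Hardy.rotation (c : ι → Circle) : Hardy ι E →L[ℂ] Hardy ι E :=
  LinearIsometry.toContinuousLinearMap
    { toFun := fun f => ⟨fun k => (∏ i, (c i : ℂ) ^ k i) • f k,
        (Hardy.memℓp_iff _).2 (by simpa [norm_smul, Circle.norm_coe] using f.summable_sq)⟩
      map_add' := fun f g => lp.ext (funext fun k => smul_add _ _ _)
      map_smul' := fun a f => lp.ext (funext fun k => smul_comm _ _ _)
      norm_map' := fun f => by
        rw [← sq_eq_sq₀ (norm_nonneg _) (norm_nonneg _), Hardy.norm_sq, Hardy.norm_sq]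
        simp [norm_smul, Circle.norm_coe] }

/-- The shift `M_{z_m} f(z) = z_m f(z)`, that is `∑ a_k z^k ↦ ∑ a_k z^{k + e_m}`. -/
def Hardy.shift [DecidableEq ι] (m : ι) : Hardy ι E →L[ℂ] Hardy ι E :=
  LinearIsometry.toContinuousLinearMap
    { toFun := fun f => ⟨fun k => if k m = 0 then 0 else f (k - Pi.single m 1),
        (Hardy.memℓp_iff _).2 (by
          rw [← (Hardy.shift_inj m).summable_iff fun k hk => by
            simp [Hardy.shift_support m k hk]]
          simpa [Function.comp_def] using f.summable_sq)⟩
      map_add' := fun f g => lp.ext <| funext fun k => by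
        change (if k m = 0 then 0 else f (k - Pi.single m 1) + g (k - Pi.single m 1)) =
          (if k m = 0 then 0 else f (k - Pi.single m 1)) +
            if k m = 0 then 0 else g (k - Pi.single m 1)
        split_ifs <;> simp
      map_smul' := fun a f => by ext k; by_cases hk : k m = 0 <;> simp [hk]
      norm_map' := fun f => by
        rw [← sq_eq_sq₀ (norm_nonneg _) (norm_nonneg _), Hardy.norm_sq, Hardy.norm_sq,
          ← (Hardy.shift_inj m).tsum_eq (fun k hk => by
            by_contra h
            exact hk (by simp [Hardy.shift_support m k h]))]
        simp }

/-- On the open polydisc the series defining `f(z)` converges absolutely. -/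
theorem Hardy.summable_eval (f : Hardy ι E) (z : ι → ℂ) (hz : ∀ i, ‖z i‖ < 1) :
    Summable fun k : ι → ℕ => ‖(∏ i, z i ^ k i) • f k‖ := by
  classical
  have h1 : Summable fun k : ι → ℕ => ∏ i, (‖z i‖ ^ 2) ^ k i := by
    have hg : ∀ i, Summable fun j : ℕ => (‖z i‖ ^ 2) ^ j := fun i =>
      summable_geometric_of_lt_one (by positivity)
        (pow_lt_one₀ (norm_nonneg _) (hz i) two_ne_zero)
    refine summable_of_sum_le (c := ∏ i, ∑' j : ℕ, (‖z i‖ ^ 2) ^ j)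
      (fun k => by positivity) fun u => ?_
    calc ∑ k ∈ u, ∏ i, (‖z i‖ ^ 2) ^ k i
        ≤ ∑ k ∈ Fintype.piFinset fun i => u.image (fun k => k i), ∏ i, (‖z i‖ ^ 2) ^ k i := by
          refine Finset.sum_le_sum_of_subset_of_nonneg (fun k hk => ?_)
            (fun k _ _ => by positivity)
          exact Fintype.mem_piFinset.2 fun i => Finset.mem_image_of_mem _ hk
      _ = ∏ i, ∑ j ∈ u.image (fun k => k i), (‖z i‖ ^ 2) ^ j :=
          (Finset.prod_univ_sum _ _).symm
      _ ≤ _ := Finset.prod_le_prod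
          (fun i _ => Finset.sum_nonneg fun j _ => by positivity)
          fun i _ => (hg i).sum_le_tsum _ fun j _ => by positivity
  refine Summable.of_nonneg_of_le (fun k => norm_nonneg _) (fun k => ?_)
    (h1.add f.summable_sq)
  have h2 : (∏ i, (‖z i‖ ^ 2) ^ k i) = (∏ i, ‖z i‖ ^ k i) ^ 2 := by
    rw [← Finset.prod_pow]
    exact Finset.prod_congr rfl fun i _ => by rw [← pow_mul, ← pow_mul, mul_comm]
  rw [norm_smul, norm_prod, h2]
  simp only [norm_pow]
  nlinarith [sq_nonneg ((∏ i, ‖z i‖ ^ k i) - ‖f k‖), sq_nonneg (∏ i, ‖z i‖ ^ k i),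
    sq_nonneg ‖f k‖]

theorem Hardy.eval_rotation (c : ι → Circle) (f : Hardy ι E) (z : ι → ℂ) :
    (Hardy.rotation c f).eval z = f.eval fun i => c i * z i := by
  refine tsum_congr fun k => ?_
  change (∏ i, z i ^ k i) • (∏ i, (c i : ℂ) ^ k i) • f k = _
  rw [smul_smul]
  congr 1
  simp [mul_pow, Finset.prod_mul_distrib, mul_comm]

theorem Hardy.eval_shift [DecidableEq ι] (m : ι) (f : Hardy ι E) (z : ι → ℂ) :
    (Hardy.shift m f).eval z = z m • f.eval z := by
  unfold Hardy.eval
  rw [← tsum_const_smul'', ← (Hardy.shift_inj m).tsum_eq]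
  · refine tsum_congr fun k => ?_
    change (∏ i, z i ^ (k + Pi.single m 1 : ι → ℕ) i) •
      (if (k + Pi.single m 1 : ι → ℕ) m = 0 then 0
        else f (k + Pi.single m 1 - Pi.single m 1)) = _
    rw [smul_smul]
    simp only [Pi.add_apply, pow_add, Finset.prod_mul_distrib, add_tsub_cancel_right]
    have : ∏ i, z i ^ (Pi.single m 1 : ι → ℕ) i = z m := by
      rw [Finset.prod_eq_single m] <;> simp +contextual
    rw [this]
    simp [mul_comm]
  · intro k hk
    by_contra h
    refine hk ?_
    change (∏ i, z i ^ k i) • (if k m = 0 then 0 else f (k - Pi.single m 1)) = 0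
    simp [Hardy.shift_support m k h]

end Hardy

/-! ## Rotational shifts and direct sums -/

section Dilation

variable {n : ℕ}

/-- For `G ⊆ {1,…,n}` and `m ∈ G`, the rotational shift `M_{z_m} R_{[q]_m}` on the Hardy space
`H²_E(𝔻^{|G|})`, whose variables `z_i` are indexed by `i ∈ G`; here
`[q]_m = (q(m,i)^{1/2})_{i ∈ G}` with the chosen square roots `s(m,i) = q(m,i)^{1/2}`. -/
def rotationalShift (s : Fin n → Fin n → Circle) (G : Finset (Fin n)) (m : G)
    (E : Type*) [NormedAddCommGroup E] [InnerProductSpace ℂ E] :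
    Hardy G E →L[ℂ] Hardy G E :=
  Hardy.shift m ∘L Hardy.rotation (fun i : G => s m i)

/-- The orthogonal direct sum `⊕_a A_a` of finitely many operators, on the Hilbert space direct
sum `⊕_a K_a`. -/
def directSumOp {α : Type*} [Fintype α] {K : α → Type*} [∀ a, NormedAddCommGroup (K a)]
    [∀ a, InnerProductSpace ℂ (K a)] (A : ∀ a, K a →L[ℂ] K a) : PiLp 2 K →L[ℂ] PiLp 2 K :=
  ((PiLp.continuousLinearEquiv 2 ℂ K).symm : (∀ a, K a) →L[ℂ] PiLp 2 K) ∘L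
    ContinuousLinearMap.piMap A ∘L
      ((PiLp.continuousLinearEquiv 2 ℂ K) : PiLp 2 K →L[ℂ] ∀ a, K a)

end Dilation

end QComm

end

/-! Adjoining square-root phases to products of the `T i` gives Weyl monomials `T^{(a)}`, indexed by
multisets, with `T^{(a)} T^{(b)} = σ(a,b) T^{(a+b)}` and `σ` unimodular. Norms do not see `σ`, so
quadratic expressions in the adjoints of monomials behave as for a commuting tuple.

Let `Δ_G` be the quadratic form of the Szegő sum of `G`. Since `Δ_{G∪{j}}(h) = Δ_G(h) - Δ_G(T_j^*
h)` for `j ∉ G` (`szegoForm_insert`), Brehmer positivity makes `T_j^*` contractive for `Δ_G`. Hence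
`Δ_G` decreases along the powers of the adjoint of the monomial of `Gᶜ`, to a limit form `d_G`.

Expanding a product of telescoping geometric sums (`sum_box`) writes `‖h‖²` as a sum over `G` of
values of `Δ_G` over a box of side `M`. Letting `M → ∞` gives `‖h‖² = ∑_G ∑_k d_G(T^{(k)*} h)`, with
`k` running over the multi-indices on `G` (`sum_tsum_eq_norm_sq`).

The form `d_G` is invariant under each `T_j^*` with `j ∉ G`. A Hilbert space `E_G` with a map `ι_G`
satisfying `‖ι_G x‖² = d_G(x)` can be taken large enough that these operators become unitaries
(`ContractiveForm.exists_unitary_model`). The dilation sends `h` to the power series with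
coefficients `ι_G(T^{(k)*} h)`. On coefficients, `T_j^*` becomes a weighted backward shift if `j ∈
G` and a diagonal unitary otherwise. -/

noncomputable section

namespace QComm

/-! ## Weyl-ordered monomials -/

section Weyl

variable {n : ℕ} {H : Type*} [NormedAddCommGroup H] [InnerProductSpace ℂ H]

/-- The bicharacter `σ(a,b) = ∏_{i ∈ a} ∏_{j ∈ b} s(i,j)`. -/
def bichar (s : Fin n → Fin n → Circle) (a b : Multiset (Fin n)) : Circle :=
  (a.map fun i => (b.map (s i)).prod).prod

@[simp]
theorem bichar_zero_left (s : Fin n → Fin n → Circle) (b : Multiset (Fin n)) :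
    bichar s 0 b = 1 := by simp [bichar]

@[simp]
theorem bichar_zero_right (s : Fin n → Fin n → Circle) (a : Multiset (Fin n)) :
    bichar s a 0 = 1 := by simp [bichar]

theorem bichar_add_left (s : Fin n → Fin n → Circle) (a a' b : Multiset (Fin n)) :
    bichar s (a + a') b = bichar s a b * bichar s a' b := by simp [bichar]

theorem bichar_add_right (s : Fin n → Fin n → Circle) (a b b' : Multiset (Fin n)) :
    bichar s a (b + b') = bichar s a b * bichar s a b' := by simp [bichar]

theorem bichar_singleton (s : Fin n → Fin n → Circle) (i j : Fin n) :
    bichar s {i} {j} = s i j := by simp [bichar]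

theorem IsSqrtChoice.inv_symm {q s : Fin n → Fin n → Circle} (hs : IsSqrtChoice q s)
    (i j : Fin n) : s i j = (s j i)⁻¹ :=
  Circle.ext (by rw [hs.conj_symm, Circle.coe_inv_eq_conj])

theorem IsSqrtChoice.bichar_symm {q s : Fin n → Fin n → Circle} (hs : IsSqrtChoice q s)
    (a b : Multiset (Fin n)) : bichar s a b = (bichar s b a)⁻¹ := by
  have h1 : ∀ (i : Fin n) (b : Multiset (Fin n)), bichar s {i} b = (bichar s b {i})⁻¹ := by
    intro i b
    induction b using Multiset.induction with
    | empty => simp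
    | cons j b ih =>
      rw [← Multiset.singleton_add, bichar_add_left, bichar_add_right, ih, bichar_singleton,
        bichar_singleton, hs.inv_symm i j, mul_inv]
  induction a using Multiset.induction with
  | empty => simp
  | cons i a ih =>
    rw [← Multiset.singleton_add, bichar_add_left, bichar_add_right, ih, h1, mul_inv]

theorem IsSqrtChoice.bichar_self {q s : Fin n → Fin n → Circle} (hs : IsSqrtChoice q s)
    (a : Multiset (Fin n)) : bichar s a a = 1 := by
  induction a using Multiset.induction with
  | empty => simp
  | cons i a ih =>
    rw [← Multiset.singleton_add, bichar_add_left, bichar_add_right, bichar_add_right, ih,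
      bichar_singleton, hs.diag, hs.bichar_symm a {i}]
    simp

/-- The Weyl-ordered product of the operators `T_i`, `i ∈ l`. -/
def weylList (s : Fin n → Fin n → Circle) (T : Fin n → H →L[ℂ] H) :
    List (Fin n) → H →L[ℂ] H
  | [] => 1
  | i :: l => (((bichar s {i} l)⁻¹ : Circle) : ℂ) • (T i * weylList s T l)

/-- Only a swap of neighbours has content: the phase `q j i = s j i ^ 2` it produces is absorbed by
replacing `(s j i)⁻¹` with `(s i j)⁻¹ = s j i` in the normalization. -/
theorem weylList_perm {q s : Fin n → Fin n → Circle} (hs : IsSqrtChoice q s)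
    {T : Fin n → H →L[ℂ] H} (hT : IsQCommuting q T) {l l' : List (Fin n)} (h : l.Perm l') :
    weylList s T l = weylList s T l' := by
  induction h with
  | nil => rfl
  | cons i h ih => simp only [weylList, ih, Multiset.coe_eq_coe.2 h]
  | trans _ _ ih ih' => exact ih.trans ih'
  | swap i j l =>
    have hij : T j * T i = ((q j i : Circle) : ℂ) • (T i * T j) := hT j i
    have key : (bichar s {j} (i :: l : List (Fin n)))⁻¹ * (bichar s {i} l)⁻¹ * q j i =
        (bichar s {i} (j :: l : List (Fin n)))⁻¹ * (bichar s {j} l)⁻¹ := by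
      rw [← Multiset.cons_coe, ← Multiset.cons_coe, ← Multiset.singleton_add,
        ← Multiset.singleton_add, bichar_add_right, bichar_add_right, bichar_singleton,
        bichar_singleton, ← hs.sq, hs.inv_symm i j]
      have h1 : ∀ x y z : Circle, (x * y)⁻¹ * z⁻¹ * x ^ 2 = (x⁻¹ * z)⁻¹ * y⁻¹ := fun x y z => by
        rw [mul_inv, mul_inv, inv_inv, sq, mul_comm _ (x * x), mul_assoc, mul_assoc,
          mul_inv_cancel_left, mul_comm y⁻¹, mul_assoc]
      exact h1 _ _ _
    simp only [weylList, mul_smul_comm, smul_smul, ← mul_assoc, hij, smul_mul_assoc]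
    rw [← Circle.coe_mul, ← Circle.coe_mul, ← Circle.coe_mul, key]

/-- The Weyl-ordered monomial `T^{(a)}`; it is normalized so that
`T^{(a)} T^{(b)} = σ(a,b) T^{(a+b)}`. -/
def weyl {q s : Fin n → Fin n → Circle} (hs : IsSqrtChoice q s)
    {T : Fin n → H →L[ℂ] H} (hT : IsQCommuting q T) (a : Multiset (Fin n)) : H →L[ℂ] H :=
  Quotient.lift (weylList s T) (fun _ _ h => weylList_perm hs hT h) a

variable {q s : Fin n → Fin n → Circle} (hs : IsSqrtChoice q s)
    {T : Fin n → H →L[ℂ] H} (hT : IsQCommuting q T)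

@[simp]
theorem weyl_zero : weyl hs hT 0 = 1 := rfl

theorem weyl_cons (i : Fin n) (a : Multiset (Fin n)) :
    weyl hs hT (i ::ₘ a) = (((bichar s {i} a)⁻¹ : Circle) : ℂ) • (T i * weyl hs hT a) := by
  induction a using Quotient.inductionOn with
  | _ l => rfl

theorem weyl_singleton (i : Fin n) : weyl hs hT {i} = T i := by
  rw [← Multiset.cons_zero, weyl_cons]
  simp

theorem weyl_mul (a b : Multiset (Fin n)) :
    weyl hs hT a * weyl hs hT b = (bichar s a b : ℂ) • weyl hs hT (a + b) := by
  induction a using Multiset.induction with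
  | empty => simp
  | cons i a ih =>
    rw [Multiset.cons_add, weyl_cons, weyl_cons, smul_mul_assoc, mul_assoc, ih, mul_smul_comm,
      smul_smul, smul_smul]
    rw [← Circle.coe_mul, ← Circle.coe_mul, ← Multiset.singleton_add, bichar_add_left,
      bichar_add_right, mul_inv]
    have h1 : ∀ x y z : Circle, x⁻¹ * y = y * z * (x⁻¹ * z⁻¹) := fun x y z => by
      rw [mul_comm y, mul_comm x⁻¹ z⁻¹, mul_assoc, mul_left_comm y, mul_inv_cancel_left, mul_comm]
    rw [h1 _ _ (bichar s {i} b), mul_comm (bichar s a b) (bichar s {i} b)]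

theorem weyl_commute (a b : Multiset (Fin n)) :
    weyl hs hT a * weyl hs hT b
      = ((bichar s a b ^ 2 : Circle) : ℂ) • (weyl hs hT b * weyl hs hT a) := by
  rw [weyl_mul, weyl_mul, smul_smul, ← Circle.coe_mul, hs.bichar_symm b a, add_comm b a, sq,
    mul_inv_cancel_right]

theorem list_prod_eq_weyl (l : List (Fin n)) :
    ∃ c : Circle, (l.map T).prod = (c : ℂ) • weyl hs hT l := by
  induction l with
  | nil => exact ⟨1, by rw [Circle.coe_one, one_smul]; rfl⟩
  | cons i l ih =>
    obtain ⟨c, hc⟩ := ih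
    refine ⟨c * bichar s {i} l, ?_⟩
    rw [List.map_cons, List.prod_cons, hc, ← Multiset.cons_coe, weyl_cons, smul_smul,
      mul_smul_comm, ← Circle.coe_mul, mul_inv_cancel_right]

theorem tupleProd_eq_weyl (F : Finset (Fin n)) :
    ∃ c : Circle, tupleProd T F = (c : ℂ) • weyl hs hT F.val := by
  simpa [tupleProd] using list_prod_eq_weyl hs hT (F.sort (· ≤ ·))

theorem weyl_pow (a : Multiset (Fin n)) (N : ℕ) :
    ∃ c : Circle, weyl hs hT a ^ N = (c : ℂ) • weyl hs hT (N • a) := by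
  induction N with
  | zero => exact ⟨1, by simp⟩
  | succ N ih =>
    obtain ⟨c, hc⟩ := ih
    exact ⟨c * bichar s (N • a) a, by
      rw [pow_succ, hc, smul_mul_assoc, weyl_mul, smul_smul, ← Circle.coe_mul, succ_nsmul]⟩

end Weyl

/-! ## The Szegő forms -/

section Szego

open ContinuousLinearMap

variable {n : ℕ} {H : Type*} [NormedAddCommGroup H] [InnerProductSpace ℂ H] [CompleteSpace H]

/-- The quadratic form `⟨(∑_{F ⊆ G} (-1)^{|F|} T_F T_F^*) h, h⟩`. -/
def szegoForm (T : Fin n → H →L[ℂ] H) (G : Finset (Fin n)) (h : H) : ℝ :=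
  (inner ℂ (szegoSum T G h) h).re

theorem szegoForm_smul (T : Fin n → H →L[ℂ] H) (G : Finset (Fin n)) (c : Circle) (h : H) :
    szegoForm T G ((c : ℂ) • h) = szegoForm T G h := by
  rw [szegoForm, map_smul, inner_smul_left, inner_smul_right, ← mul_assoc, mul_comm (conj _),
    Complex.mul_conj, Complex.normSq_eq_norm_sq, Circle.norm_coe]
  simp [szegoForm]

theorem szegoForm_nonneg {T : Fin n → H →L[ℂ] H} (hB : BrehmerPositive T) (G : Finset (Fin n))
    (h : H) : 0 ≤ szegoForm T G h :=
  (hB G).re_inner_nonneg_left h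

variable {q s : Fin n → Fin n → Circle} (hs : IsSqrtChoice q s)
    {T : Fin n → H →L[ℂ] H} (hT : IsQCommuting q T)

theorem szegoForm_eq (G : Finset (Fin n)) (h : H) :
    szegoForm T G h
      = ∑ F ∈ G.powerset, (-1) ^ F.card * ‖adjoint (weyl hs hT F.val) h‖ ^ 2 := by
  simp only [szegoForm, szegoSum, sum_apply, sum_inner, Complex.re_sum]
  refine Finset.sum_congr rfl fun F _ => ?_
  obtain ⟨c, hc⟩ := tupleProd_eq_weyl hs hT F
  have h1 : inner ℂ ((tupleProd T F ∘L adjoint (tupleProd T F)) h) h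
      = ((‖adjoint (weyl hs hT F.val) h‖ ^ 2 : ℝ) : ℂ) := by
    rw [comp_apply, ← adjoint_inner_right, inner_self_eq_norm_sq_to_K, hc]
    simp [map_smulₛₗ, norm_smul, Circle.norm_coe]
  rw [smul_apply, inner_smul_left, h1, map_pow, map_neg, map_one]
  norm_cast

theorem norm_adjoint_weyl_weyl (a b : Multiset (Fin n)) (h : H) :
    ‖adjoint (weyl hs hT b) (adjoint (weyl hs hT a) h)‖ = ‖adjoint (weyl hs hT (a + b)) h‖ := by
  rw [← comp_apply, ← adjoint_comp, ← mul_def, weyl_mul, map_smulₛₗ, smul_apply, norm_smul]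
  simp [Circle.norm_coe]

theorem szegoForm_adjoint_weyl (G : Finset (Fin n)) (a : Multiset (Fin n)) (h : H) :
    szegoForm T G (adjoint (weyl hs hT a) h)
      = ∑ F ∈ G.powerset, (-1) ^ F.card * ‖adjoint (weyl hs hT (a + F.val)) h‖ ^ 2 := by
  simp only [szegoForm_eq hs hT, norm_adjoint_weyl_weyl]

theorem szegoForm_adjoint_adjoint (G : Finset (Fin n)) (a b : Multiset (Fin n)) (h : H) :
    szegoForm T G (adjoint (weyl hs hT b) (adjoint (weyl hs hT a) h))
      = szegoForm T G (adjoint (weyl hs hT (a + b)) h) := by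
  rw [← comp_apply, ← adjoint_comp, ← mul_def, weyl_mul, map_smulₛₗ, smul_apply,
    ← Circle.coe_inv_eq_conj, szegoForm_smul]

-- Split the subsets of `insert j G` according to whether they contain `j`. This recursion turns
-- positivity for `insert j G` into contractivity of `T_j^*` for the form of `G`.
include hs hT in
theorem szegoForm_insert {G : Finset (Fin n)} {j : Fin n} (hj : j ∉ G) (h : H) :
    szegoForm T (insert j G) h = szegoForm T G h - szegoForm T G (adjoint (T j) h) := by
  have h1 := szegoForm_adjoint_weyl hs hT G {j} h
  rw [weyl_singleton] at h1
  rw [h1, szegoForm_eq hs hT, szegoForm_eq hs hT, Finset.sum_powerset_insert hj, sub_eq_add_neg,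
    ← Finset.sum_neg_distrib]
  congr 1
  refine Finset.sum_congr rfl fun F hF => ?_
  have hjF : j ∉ F := fun h' => hj (Finset.mem_powerset.1 hF h')
  rw [Finset.card_insert_of_notMem hjF, Finset.insert_val_of_notMem hjF,
    Multiset.singleton_add, pow_succ]
  ring

theorem szegoForm_adjoint_weyl_le (hB : BrehmerPositive T) {G : Finset (Fin n)}
    (a : Multiset (Fin n)) (ha : ∀ j ∈ a, j ∉ G) (h : H) :
    szegoForm T G (adjoint (weyl hs hT a) h) ≤ szegoForm T G h := by
  induction a using Multiset.induction generalizing h with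
  | empty => simp [← ContinuousLinearMap.star_eq_adjoint]
  | cons j a ih =>
    have h1 := szegoForm_insert hs hT (ha j (Multiset.mem_cons_self j a)) h
    have h2 := szegoForm_nonneg hB (insert j G) h
    have h3 := ih (fun i hi => ha i (Multiset.mem_cons_of_mem hi)) (adjoint (T j) h)
    rw [← weyl_singleton hs hT j, szegoForm_adjoint_adjoint, Multiset.singleton_add,
      weyl_singleton] at h3
    linarith

end Szego

/-! ## Decomposition of a function of multisets into boxes -/

section Box

variable {α : Type*}

/-- The multiset on `G` with multiplicities `k`. -/
def multiIndex {G : Finset α} (k : G → ℕ) : Multiset α := ∑ i, k i • {(i : α)}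

variable [DecidableEq α]

theorem multiIndex_add_single {G : Finset α} (k : G → ℕ) (i : G) :
    multiIndex (k + Pi.single i 1) = {(i : α)} + multiIndex k := by
  simp only [multiIndex, Pi.add_apply, add_smul, Finset.sum_add_distrib]
  rw [add_comm, Finset.sum_eq_single i] <;> simp +contextual

theorem sum_box (g : Multiset α → ℝ) (I : Finset α) (M : ℕ) :
    ∑ G ∈ I.powerset, ∑ k ∈ Fintype.piFinset fun _ : G => Finset.range M,
      ∑ F ∈ G.powerset, (-1) ^ F.card * g (multiIndex k + M • (I \ G).val + F.val) = g 0 := by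
  -- The identity is linear in `g`, so it suffices to prove it for formal monomials `e m` in the
  -- monoid algebra, where it is a polynomial identity, and then to apply the linear functional `e m
  -- ↦ g m`.
  let e : Multiset α → AddMonoidAlgebra ℝ (Multiset α) := fun m => AddMonoidAlgebra.single m 1
  have e_zero : e 0 = 1 := rfl
  have e_add : ∀ a b, e (a + b) = e a * e b := fun a b => by
    simp [e, AddMonoidAlgebra.single_mul_single]
  have e_nsmul : ∀ (N : ℕ) a, e (N • a) = e a ^ N := fun N a => by
    induction N with
    | zero => simp [e_zero]
    | succ N ih => rw [succ_nsmul, e_add, ih, pow_succ]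
  have e_sum : ∀ {β : Type _} (S : Finset β) (f : β → Multiset α),
      e (∑ i ∈ S, f i) = ∏ i ∈ S, e (f i) := fun S f => by
    classical
    induction S using Finset.induction with
    | empty => simp [e_zero]
    | insert i S hi ih => rw [Finset.sum_insert hi, Finset.prod_insert hi, e_add, ih]
  have e_val : ∀ F : Finset α, e F.val = ∏ i ∈ F, e {i} := fun F => by
    rw [← e_sum, Finset.sum_multiset_singleton]
  let L : AddMonoidAlgebra ℝ (Multiset α) →ₗ[ℝ] ℝ :=
    Finsupp.linearCombination ℝ g ∘ₗ (AddMonoidAlgebra.coeffLinearEquiv ℝ).toLinearMap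
  have L_e : ∀ m, L (e m) = g m := fun m => by simp [L, e]
  have key : ∑ G ∈ I.powerset, ∑ k ∈ Fintype.piFinset fun _ : G => Finset.range M,
      ∑ F ∈ G.powerset, ((-1 : ℝ) ^ F.card) • e (multiIndex k + M • (I \ G).val + F.val)
        = e 0 := by
    -- Each factor telescopes to 1. Expanding the product, `G` records the indices at which the
    -- summand with the geometric sum is chosen.
    have h1 : ∏ i ∈ I, ((∑ k ∈ Finset.range M, e {i} ^ k) * (1 - e {i}) + e {i} ^ M) = 1 := by
      refine Finset.prod_eq_one fun i _ => ?_
      rw [geom_sum_mul_neg, sub_add_cancel]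
    rw [e_zero, ← h1, Finset.prod_add]
    refine Finset.sum_congr rfl fun G _ => ?_
    rw [Finset.prod_mul_distrib, Finset.prod_pow, ← e_val, ← e_nsmul,
      ← Finset.prod_coe_sort G, Finset.prod_univ_sum, Finset.prod_sub, Finset.sum_mul_sum,
      Finset.sum_mul]
    refine Finset.sum_congr rfl fun k _ => ?_
    rw [Finset.sum_mul]
    refine Finset.sum_congr rfl fun F _ => ?_
    rw [e_add, e_add, e_val F, multiIndex, e_sum]
    simp only [e_nsmul]
    rw [Finset.prod_const_one, mul_one, Algebra.smul_def]
    simp only [map_pow, map_neg, map_one]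
    ring
  have h2 := congrArg L key
  simpa only [map_sum, map_smul, L_e, smul_eq_mul] using h2

end Box

/-! ### Box decomposition of the norm and its limit -/

section BoxSzego

open ContinuousLinearMap Filter Topology

variable {n : ℕ} {H : Type*} [NormedAddCommGroup H] [InnerProductSpace ℂ H] [CompleteSpace H]
  {q s : Fin n → Fin n → Circle} (hs : IsSqrtChoice q s)
  {T : Fin n → H →L[ℂ] H} (hT : IsQCommuting q T)

theorem sum_szegoForm_box (I : Finset (Fin n)) (M : ℕ) (h : H) :
    ∑ G ∈ I.powerset, ∑ k ∈ Fintype.piFinset fun _ : G => Finset.range M,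
      szegoForm T G (adjoint (weyl hs hT (multiIndex k + M • (I \ G).val)) h) = ‖h‖ ^ 2 := by
  have := sum_box (fun a => ‖adjoint (weyl hs hT a) h‖ ^ 2) I M
  simp only [szegoForm_adjoint_weyl]
  rw [this, weyl_zero, ← star_eq_adjoint, star_one]
  rfl

variable (hB : BrehmerPositive T)
include hB

/-- In the box identity with `I = G`, the term indexed by `G` itself carries no power `M`; all terms
are nonnegative, so its partial sums are at most `‖h‖ ^ 2`. -/
theorem summable_szegoForm (G : Finset (Fin n)) (h : H) :
    Summable fun k : G → ℕ => szegoForm T G (adjoint (weyl hs hT (multiIndex k)) h) := by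
  refine summable_of_sum_le (c := ‖h‖ ^ 2) (fun k => szegoForm_nonneg hB _ _) fun u => ?_
  obtain ⟨M, hM⟩ : ∃ M, u ⊆ Fintype.piFinset fun _ : G => Finset.range M := by
    refine ⟨u.sup (fun k => ∑ i, k i) + 1, fun k hk => ?_⟩
    refine Fintype.mem_piFinset.2 fun i => Finset.mem_range.2 (Nat.lt_succ_of_le ?_)
    exact (Finset.single_le_sum (f := k) (fun _ _ => Nat.zero_le _) (Finset.mem_univ i)).trans
      (Finset.le_sup (f := fun k : G → ℕ => ∑ i, k i) hk)
  calc _ ≤ ∑ k ∈ Fintype.piFinset fun _ : G => Finset.range M,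
        szegoForm T G (adjoint (weyl hs hT (multiIndex k)) h) :=
        Finset.sum_le_sum_of_subset_of_nonneg hM fun k _ _ => szegoForm_nonneg hB _ _
    _ ≤ ‖h‖ ^ 2 := by
        rw [← sum_szegoForm_box hs hT G M h]
        refine le_trans (le_of_eq ?_) (Finset.single_le_sum (f := fun G' : Finset (Fin n) =>
          ∑ k ∈ Fintype.piFinset fun _ : G' => Finset.range M,
            szegoForm T G' (adjoint (weyl hs hT (multiIndex k + M • (G \ G').val)) h))
          (fun G' _ => Finset.sum_nonneg fun k _ => szegoForm_nonneg hB _ _)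
          (Finset.mem_powerset_self G))
        simp

/-- If `d G` is the limit of the Szegő form of `G` along the powers of the monomial of `Gᶜ`, then
`d G` summed over the monomials of `G`, and over all `G`, gives the norm. -/
theorem sum_tsum_eq_norm_sq (d : Finset (Fin n) → H → ℝ)
    (hd : ∀ G x, Tendsto (fun N : ℕ => szegoForm T G (adjoint (weyl hs hT (N • Gᶜ.val)) x)) atTop
      (𝓝 (d G x))) (h : H) :
    (∀ G : Finset (Fin n), Summable fun k : G → ℕ =>
      d G (adjoint (weyl hs hT (multiIndex k)) h)) ∧
    ∑ G : Finset (Fin n), ∑' k : G → ℕ, d G (adjoint (weyl hs hT (multiIndex k)) h) = ‖h‖ ^ 2 := by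
  have hle : ∀ (G : Finset (Fin n)) (N : ℕ) (x : H),
      szegoForm T G (adjoint (weyl hs hT (N • Gᶜ.val)) x) ≤ szegoForm T G x := fun G N x =>
    szegoForm_adjoint_weyl_le hs hT hB _ (fun j hj => by
      simpa using Multiset.mem_of_mem_nsmul hj) x
  have hd0 : ∀ G x, 0 ≤ d G x := fun G x =>
    ge_of_tendsto' (hd G x) fun N => szegoForm_nonneg hB _ _
  have hd1 : ∀ G x, d G x ≤ szegoForm T G x := fun G x => le_of_tendsto' (hd G x) (hle G · x)
  refine ⟨fun G => Summable.of_nonneg_of_le (fun k => hd0 _ _) (fun k => hd1 _ _)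
    (summable_szegoForm hs hT hB G h), ?_⟩
  have hlim : ∀ G : Finset (Fin n), Tendsto (fun M : ℕ =>
      ∑ k ∈ Fintype.piFinset fun _ : G => Finset.range M,
        szegoForm T G (adjoint (weyl hs hT (multiIndex k + M • Gᶜ.val)) h)) atTop
      (𝓝 (∑' k : G → ℕ, d G (adjoint (weyl hs hT (multiIndex k)) h))) := by
    intro G
    -- The box sum is a series over all `k` cut off by an indicator; it is dominated by the values
    -- of the form without the factor `M • Gᶜ`.
    have h1 := tendsto_tsum_of_dominated_convergence (𝓕 := atTop)
      (f := fun (M : ℕ) (k : G → ℕ) =>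
        ((Fintype.piFinset fun _ : G => Finset.range M : Finset (G → ℕ)) : Set (G → ℕ)).indicator
          (fun k => szegoForm T G (adjoint (weyl hs hT (multiIndex k + M • Gᶜ.val)) h)) k)
      (g := fun k => d G (adjoint (weyl hs hT (multiIndex k)) h))
      (summable_szegoForm hs hT hB G h) (fun k => ?_) (Eventually.of_forall fun M k => ?_)
    · refine h1.congr fun M => ?_
      rw [tsum_eq_sum (s := Fintype.piFinset fun _ : G => Finset.range M)]
      · exact Finset.sum_congr rfl fun k hk => Set.indicator_of_mem (Finset.mem_coe.2 hk) _
      · exact fun k hk => Set.indicator_of_notMem (fun h => hk (Finset.mem_coe.1 h)) _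
    · refine (hd G _).congr' ?_
      filter_upwards [eventually_gt_atTop (∑ i, k i)] with M hM
      rw [Set.indicator_of_mem, szegoForm_adjoint_adjoint]
      refine Finset.mem_coe.2 (Fintype.mem_piFinset.2 fun i => Finset.mem_range.2
        (lt_of_le_of_lt ?_ hM))
      exact Finset.single_le_sum (f := k) (fun _ _ => Nat.zero_le _) (Finset.mem_univ i)
    · refine (norm_indicator_le_norm_self _ _).trans ?_
      rw [Real.norm_of_nonneg (szegoForm_nonneg hB _ _), ← szegoForm_adjoint_adjoint]
      exact hle _ _ _
  refine tendsto_nhds_unique (tendsto_finsetSum _ fun G _ => hlim G) ?_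
  have h2 : ∀ M, ∑ G : Finset (Fin n), ∑ k ∈ Fintype.piFinset fun _ : G => Finset.range M,
        szegoForm T G (adjoint (weyl hs hT (multiIndex k + M • Gᶜ.val)) h) = ‖h‖ ^ 2 := by
    intro M
    rw [← sum_szegoForm_box hs hT Finset.univ M h, Finset.powerset_univ]
    rfl
  simp only [h2]
  exact tendsto_const_nhds

end BoxSzego

/-! ## Unitary extensions -/

section UnitaryModel

open Filter Topology UniformSpace

variable {H : Type*} [NormedAddCommGroup H] [InnerProductSpace ℂ H]

/-- A positive form `⟨S x, x⟩` together with an operator `A` that does not increase it. -/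
structure ContractiveForm (H : Type*) [NormedAddCommGroup H] [InnerProductSpace ℂ H] where
  /-- The operator representing the form. -/
  form : H →L[ℂ] H
  /-- The operator that does not increase the form. -/
  op : H →L[ℂ] H
  isPositive : form.IsPositive
  le : ∀ x, (inner ℂ (form (op x)) (op x)).re ≤ (inner ℂ (form x) x).re

variable (φ : ContractiveForm H)

/-- The space of sequences with `x_{N+1} = A x_N` for all large `N`. -/
def coherentSubmodule : Submodule ℂ (ℕ → H) where
  carrier := {x | ∀ᶠ N in atTop, x (N + 1) = φ.op (x N)}
  add_mem' := fun {x y} hx hy => by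
    filter_upwards [hx, hy] with N h1 h2
    simp [h1, h2]
  zero_mem' := by simp
  smul_mem' := fun c x hx => by
    filter_upwards [hx] with N h1
    simp [h1]

/-- The space of sequences with `x_{N+1} = A x_N` for all large `N`, to be endowed with the
semi-inner product `lim_N ⟨S x_N, y_N⟩`. -/
def Coherent : Type _ := coherentSubmodule φ

namespace Coherent

instance : AddCommGroup (Coherent φ) := inferInstanceAs (AddCommGroup (coherentSubmodule φ))

instance : Module ℂ (Coherent φ) := inferInstanceAs (Module ℂ (coherentSubmodule φ))

variable {φ}

/-- The terms of a coherent sequence. -/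
def term (N : ℕ) : Coherent φ →ₗ[ℂ] H := LinearMap.proj N ∘ₗ (coherentSubmodule φ).subtype

/-- A coherent sequence from its terms. -/
def mk (x : ℕ → H) (hx : ∀ᶠ N in atTop, x (N + 1) = φ.op (x N)) : Coherent φ := ⟨x, hx⟩

@[simp]
theorem term_mk (x : ℕ → H) (hx : ∀ᶠ N in atTop, x (N + 1) = φ.op (x N)) (N : ℕ) :
    term N (mk x hx : Coherent φ) = x N := rfl

@[ext]
theorem ext {x y : Coherent φ} (h : ∀ N, term N x = term N y) : x = y :=
  Subtype.ext (funext h)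

theorem term_succ (x : Coherent φ) : ∀ᶠ N in atTop, term (N + 1) x = φ.op (term N x) := x.2

theorem exists_tendsto_self (x : Coherent φ) :
    ∃ l : ℂ, Tendsto (fun N => inner ℂ (φ.form (term N x)) (term N x)) atTop (𝓝 l) := by
  obtain ⟨k, hk⟩ := eventually_atTop.1 x.term_succ
  have h1 : Antitone fun N => (inner ℂ (φ.form (term (N + k) x)) (term (N + k) x)).re := by
    refine antitone_nat_of_succ_le fun N => ?_
    rw [add_right_comm, hk (N + k) (Nat.le_add_left _ _)]
    exact φ.le _
  have h2 := tendsto_atTop_ciInf h1 ⟨0, by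
    rintro _ ⟨N, rfl⟩
    exact φ.isPositive.re_inner_nonneg_left _⟩
  refine ⟨_, (tendsto_add_atTop_iff_nat k).1 ((Complex.continuous_ofReal.tendsto _).comp h2
    |>.congr fun N => ?_)⟩
  have h3 := φ.isPositive.isSymmetric.coe_re_inner_apply_self (term (N + k) x)
  exact h3

theorem exists_tendsto (x y : Coherent φ) :
    ∃ l : ℂ, Tendsto (fun N => inner ℂ (φ.form (term N x)) (term N y)) atTop (𝓝 l) := by
  obtain ⟨l1, h1⟩ := exists_tendsto_self (x + y)
  obtain ⟨l2, h2⟩ := exists_tendsto_self (x - y)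
  obtain ⟨l3, h3⟩ := exists_tendsto_self (x + Complex.I • y)
  obtain ⟨l4, h4⟩ := exists_tendsto_self (x - Complex.I • y)
  refine ⟨(l1 - l2 - Complex.I * l3 + Complex.I * l4) / 4,
    ((((h1.sub h2).sub (h3.const_mul _)).add (h4.const_mul _)).div_const _).congr fun N => ?_⟩
  simpa only [map_add, map_sub, map_smul, ContinuousLinearMap.coe_coe] using
    (inner_map_polarization' (φ.form : H →ₗ[ℂ] H) (term N x) (term N y)).symm

/-- The semi-inner product `lim_N ⟨S x_N, y_N⟩`. -/
def limInner (x y : Coherent φ) : ℂ :=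
  limUnder atTop fun N => inner ℂ (φ.form (term N x)) (term N y)

theorem tendsto_limInner (x y : Coherent φ) :
    Tendsto (fun N => inner ℂ (φ.form (term N x)) (term N y)) atTop (𝓝 (limInner x y)) :=
  tendsto_nhds_limUnder (exists_tendsto x y)

variable (φ) in
/-- The semi-inner product structure given by `limInner`. -/
abbrev preInnerProductSpaceCore : PreInnerProductSpace.Core ℂ (Coherent φ) where
  inner := limInner
  conj_inner_symm x y := by
    refine tendsto_nhds_unique ((Complex.continuous_conj.tendsto _).comp (tendsto_limInner y x))
      ((tendsto_limInner x y).congr fun N => ?_)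
    rw [Function.comp_apply, inner_conj_symm]
    exact φ.isPositive.isSymmetric _ _
  re_inner_nonneg x :=
    ge_of_tendsto' ((Complex.continuous_re.tendsto _).comp (tendsto_limInner x x)) fun N =>
      φ.isPositive.re_inner_nonneg_left _
  add_left x y z := tendsto_nhds_unique (tendsto_limInner (x + y) z)
    (((tendsto_limInner x z).add (tendsto_limInner y z)).congr fun N => by
      rw [map_add, map_add, inner_add_left])
  smul_left x y c := tendsto_nhds_unique (tendsto_limInner (c • x) y)
    (((tendsto_limInner x y).const_mul _).congr fun N => by
      rw [map_smul, map_smul, inner_smul_left])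

instance : SeminormedAddCommGroup (Coherent φ) :=
  InnerProductSpace.Core.toSeminormedAddCommGroup (c := preInnerProductSpaceCore φ)

instance : InnerProductSpace ℂ (Coherent φ) :=
  InnerProductSpace.ofCore (preInnerProductSpaceCore φ)

theorem tendsto_norm_sq (x : Coherent φ) :
    Tendsto (fun N => (inner ℂ (φ.form (term N x)) (term N x)).re) atTop (𝓝 (‖x‖ ^ 2)) := by
  rw [InnerProductSpace.norm_sq_eq_re_inner (𝕜 := ℂ) x]
  exact (Complex.continuous_re.tendsto _).comp (tendsto_limInner x x)

theorem norm_eq_zero {x : Coherent φ} (h : ∀ᶠ N in atTop, term N x = 0) : ‖x‖ = 0 := by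
  rw [← sq_eq_zero_iff]
  refine tendsto_nhds_unique (tendsto_norm_sq x) (tendsto_const_nhds.congr' ?_)
  filter_upwards [h] with N hN
  simp [hN]

theorem coe_eq_coe {x y : Coherent φ} (h : ∀ᶠ N in atTop, term N x = term N y) :
    (x : Completion (Coherent φ)) = y := by
  rw [← sub_eq_zero, ← Completion.coe_sub, ← _root_.norm_eq_zero, Completion.norm_coe]
  refine norm_eq_zero ?_
  filter_upwards [h] with N hN
  rw [map_sub, hN, sub_self]

variable (φ) in
/-- The orbit map `x ↦ (A^N x)_N`. -/
def orbit : H →ₗ[ℂ] Coherent φ where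
  toFun x := mk (fun N => (φ.op ^ N) x) (Eventually.of_forall fun N => by
    rw [pow_succ', mul_apply_eq_comp])
  map_add' x y := by ext N; simp
  map_smul' c x := by ext N; simp

/-- The operator on coherent sequences induced by an operator that commutes with `A` up to a
phase. -/
def lift (C : H →L[ℂ] H) (c : Circle) (hC : ∀ x, φ.op (C x) = (c : ℂ) • C (φ.op x)) :
    Coherent φ →ₗ[ℂ] Coherent φ where
  -- The factor `c ^ N` compensates the phase in `A C = c C A`, so that coherence is preserved.
  toFun x := mk (fun N => ((c ^ N : Circle) : ℂ) • C (term N x)) (by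
    filter_upwards [x.term_succ] with N hN
    rw [hN, map_smul, hC, smul_smul, ← Circle.coe_mul, pow_succ])
  map_add' x y := by ext N; simp
  map_smul' a x := by
    ext N
    change ((c ^ N : Circle) : ℂ) • C (term N (a • x)) = a • ((c ^ N : Circle) : ℂ) • C (term N x)
    rw [map_smul, map_smul, smul_comm]

theorem term_lift (C : H →L[ℂ] H) (c : Circle) (hC : ∀ x, φ.op (C x) = (c : ℂ) • C (φ.op x))
    (x : Coherent φ) (N : ℕ) :
    term N (lift C c hC x) = ((c ^ N : Circle) : ℂ) • C (term N x) := rfl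

/-- The delayed sequence `(x_{N-1})_N`. -/
def delay (x : Coherent φ) : Coherent φ :=
  -- At `N = 0` the truncated subtraction repeats the first term, which is harmless since only tails
  -- count.
  mk (fun N => term (N - 1) x) (by
    obtain ⟨k, hk⟩ := eventually_atTop.1 x.term_succ
    filter_upwards [eventually_ge_atTop (k + 1)] with N hN
    have := hk (N - 1) (by omega)
    rwa [Nat.sub_add_cancel (by omega)] at this)

/-- The form at `C x_N` lies between its values at `x_{N+1} = A x_N` and at `x_N`, which have the
same limit. -/
theorem norm_lift (C : H →L[ℂ] H) (c : Circle) (hC : ∀ x, φ.op (C x) = (c : ℂ) • C (φ.op x))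
    (h1 : ∀ x, (inner ℂ (φ.form (C x)) (C x)).re ≤ (inner ℂ (φ.form x) x).re)
    (h2 : ∀ x, (inner ℂ (φ.form (φ.op x)) (φ.op x)).re ≤ (inner ℂ (φ.form (C x)) (C x)).re)
    (x : Coherent φ) : ‖lift C c hC x‖ = ‖x‖ := by
  rw [← sq_eq_sq₀ (norm_nonneg _) (norm_nonneg _)]
  have hphase : ∀ N, (inner ℂ (φ.form (term N (lift C c hC x))) (term N (lift C c hC x))).re
      = (inner ℂ (φ.form (C (term N x))) (C (term N x))).re := fun N => by
    rw [term_lift, map_smul, inner_smul_left, inner_smul_right, ← mul_assoc, mul_comm (conj _),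
      Complex.mul_conj, Complex.normSq_eq_norm_sq, Circle.norm_coe]
    simp
  refine tendsto_nhds_unique ((tendsto_norm_sq (lift C c hC x)).congr hphase) ?_
  refine tendsto_of_tendsto_of_tendsto_of_le_of_le'
    ((tendsto_add_atTop_iff_nat 1).2 (tendsto_norm_sq x)) (tendsto_norm_sq x) ?_
    (Eventually.of_forall fun N => h1 _)
  filter_upwards [x.term_succ] with N hN
  rw [hN]
  exact h2 _

end Coherent

open Coherent

/-- Operators `C_j` that commute up to phases with `A` and divide it become unitary on the
Hilbert space of the limit form `lim_N ⟨S A^N x, A^N x⟩`, suitably extended. -/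
theorem ContractiveForm.exists_unitary_model {H : Type u} [NormedAddCommGroup H]
    [InnerProductSpace ℂ H] (φ : ContractiveForm H) {J : Type*} (C B : J → H →L[ℂ] H)
    (c : J → Circle) (hC : ∀ j x, φ.op (C j x) = (c j : ℂ) • C j (φ.op x))
    (hB : ∀ j x, φ.op (B j x) = (((c j)⁻¹ : Circle) : ℂ) • B j (φ.op x))
    (hCB : ∀ j x, C j (B j x) = φ.op x)
    (h1 : ∀ j x, (inner ℂ (φ.form (C j x)) (C j x)).re ≤ (inner ℂ (φ.form x) x).re)
    (h2 : ∀ j x, (inner ℂ (φ.form (φ.op x)) (φ.op x)).re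
      ≤ (inner ℂ (φ.form (C j x)) (C j x)).re) :
    ∃ (E : Type u) (_ : NormedAddCommGroup E) (_ : InnerProductSpace ℂ E) (_ : CompleteSpace E)
      (ι : H →ₗ[ℂ] E) (U : J → E ≃ₗᵢ[ℂ] E),
      (∀ x, Tendsto (fun N => (inner ℂ (φ.form ((φ.op ^ N) x)) ((φ.op ^ N) x)).re) atTop
        (𝓝 (‖ι x‖ ^ 2))) ∧
      (∀ j x, U j (ι x) = ι (C j x)) ∧
      ∀ (i j : J) (r : ℂ), (∀ x, C i (C j x) = r • C j (C i x)) →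
        ∀ x, U i (U j x) = r • U j (U i x) := by
  let L : J → Coherent φ →ₗᵢ[ℂ] Coherent φ := fun j =>
    ⟨lift (C j) (c j) (hC j), norm_lift (C j) (c j) (hC j) (h1 j) (h2 j)⟩
  let V : J → Completion (Coherent φ) →L[ℂ] Completion (Coherent φ) := fun j =>
    (L j).toContinuousLinearMap.completion
  have hV : ∀ j (x : Coherent φ), V j x = (L j x : Completion (Coherent φ)) := fun j x =>
    ContinuousLinearMap.completion_apply_coe _ _
  have hnorm : ∀ j x, ‖V j x‖ = ‖x‖ := fun j x => by
    induction x using Completion.induction_on with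
    | hp => exact isClosed_eq (V j).continuous.norm continuous_norm
    | ih x => rw [hV, Completion.norm_coe, Completion.norm_coe, (L j).norm_map]
  -- An isometry of a complete space has closed range, so it is enough to reach the dense set of
  -- coherent sequences.
  have hsurj : ∀ j, Function.Surjective (V j) := fun j => by
    have hiso : Isometry (V j) := AddMonoidHomClass.isometry_of_norm (V j) (hnorm j)
    have hcl : IsClosed (Set.range (V j)) := hiso.isClosedEmbedding.isClosed_range
    intro x
    induction x using Completion.induction_on with
    | hp => exact hcl
    | ih x =>
      -- The delay inverts `A` on tails: eventually `C_j B_j x_{N-1} = A x_{N-1} = x_N`, and the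
      -- phases `c ^ N` and `c⁻¹ ^ N` cancel.
      refine ⟨((lift (B j) (c j)⁻¹ (hB j) (delay x) : Coherent φ) : Completion _), ?_⟩
      rw [hV]
      refine coe_eq_coe ?_
      obtain ⟨k, hk⟩ := eventually_atTop.1 x.term_succ
      filter_upwards [eventually_ge_atTop (k + 1)] with N hN
      have h3 := hk (N - 1) (by omega)
      rw [Nat.sub_add_cancel (by omega)] at h3
      change ((c j ^ N : Circle) : ℂ) • C j ((((c j)⁻¹ ^ N : Circle) : ℂ) •
        B j (term (N - 1) x)) = term N x
      rw [map_smul, smul_smul, ← Circle.coe_mul, ← mul_pow, mul_inv_cancel, one_pow, hCB, h3,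
        Circle.coe_one, one_smul]
  refine ⟨Completion (Coherent φ), inferInstance, inferInstance, inferInstance,
    (Completion.toComplL : Coherent φ →L[ℂ] _).toLinearMap ∘ₗ orbit φ,
    fun j => LinearIsometryEquiv.ofSurjective ⟨(V j).toLinearMap, hnorm j⟩ (hsurj j),
    fun x => ?_, fun j x => ?_, fun i j r hr x => ?_⟩
  · change Tendsto _ _ (𝓝 (‖((orbit φ x : Coherent φ) : Completion (Coherent φ))‖ ^ 2))
    rw [Completion.norm_coe]
    exact tendsto_norm_sq (orbit φ x)
  · change V j ((orbit φ x : Coherent φ) : Completion (Coherent φ))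
      = ((orbit φ (C j x) : Coherent φ) : Completion (Coherent φ))
    rw [hV]
    congr 1
    ext N
    change ((c j ^ N : Circle) : ℂ) • C j ((φ.op ^ N) x) = (φ.op ^ N) (C j x)
    induction N with
    | zero => simp
    | succ N ih =>
      rw [pow_succ', pow_succ', mul_apply_eq_comp, mul_apply_eq_comp,
        ← ih, map_smul, hC, smul_smul, ← Circle.coe_mul, mul_comm]
  · change V i (V j x) = r • V j (V i x)
    induction x using Completion.induction_on with
    | hp =>
      exact isClosed_eq ((V i).continuous.comp (V j).continuous)
        (((V j).continuous.comp (V i).continuous).const_smul r)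
    | ih x =>
      rw [hV, hV, hV, hV, ← Completion.coe_smul]
      congr 1
      ext N
      change ((c i ^ N : Circle) : ℂ) • C i (((c j ^ N : Circle) : ℂ) • C j (term N x))
        = r • ((c j ^ N : Circle) : ℂ) • C j (((c i ^ N : Circle) : ℂ) • C i (term N x))
      rw [map_smul, map_smul, hr]
      simp only [smul_smul]
      congr 1
      ring

end UnitaryModel

open ContinuousLinearMap Filter Topology

/-! ## The model attached to a set of indices -/

section Model

variable {n : ℕ} {H : Type u} [NormedAddCommGroup H] [InnerProductSpace ℂ H] [CompleteSpace H]
  {q s : Fin n → Fin n → Circle} (hs : IsSqrtChoice q s)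
  {T : Fin n → H →L[ℂ] H} (hT : IsQCommuting q T)

theorem adjoint_weyl_comm (a b : Multiset (Fin n)) (x : H) :
    adjoint (weyl hs hT a) (adjoint (weyl hs hT b) x)
      = (((bichar s b a ^ 2)⁻¹ : Circle) : ℂ) •
        adjoint (weyl hs hT b) (adjoint (weyl hs hT a) x) := by
  rw [← comp_apply, ← comp_apply, ← adjoint_comp, ← adjoint_comp, ← mul_def, ← mul_def,
    weyl_commute hs hT b a, map_smulₛₗ, smul_apply, Circle.coe_inv_eq_conj]

theorem adjoint_weyl_mul (a b : Multiset (Fin n)) (x : H) :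
    adjoint (weyl hs hT b) (adjoint (weyl hs hT a) x)
      = conj (bichar s a b : ℂ) • adjoint (weyl hs hT (a + b)) x := by
  rw [← comp_apply, ← adjoint_comp, ← mul_def, weyl_mul, map_smulₛₗ, smul_apply]

-- Apply the unitary model with `A` the adjoint of the monomial of `Gᶜ`. Each `T_j^*` with `j ∉ G`
-- divides `A` up to a phase, the cofactor being the adjoint of the monomial of `Gᶜ \ {j}`.
include hs hT in
theorem exists_szegoForm_model (hB : BrehmerPositive T) (G : Finset (Fin n)) :
    ∃ (E : Type u) (_ : NormedAddCommGroup E) (_ : InnerProductSpace ℂ E) (_ : CompleteSpace E)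
      (ι : H →ₗ[ℂ] E) (U : {j // j ∉ G} → E ≃ₗᵢ[ℂ] E),
      (∀ x, Tendsto (fun N : ℕ => szegoForm T G (adjoint (weyl hs hT (N • Gᶜ.val)) x)) atTop
        (𝓝 (‖ι x‖ ^ 2))) ∧
      (∀ j x, U j (ι x) = ι (adjoint (T j) x)) ∧
      ∀ (i j : {j // j ∉ G}) (x : E), U i (U j x) = conj (q j i : ℂ) • U j (U i x) := by
  have hmem : ∀ j ∈ Gᶜ.val, j ∉ G := fun j hj => by simpa using hj
  have hsplit : ∀ j : {j // j ∉ G}, {(j : Fin n)} + (Gᶜ.erase j).val = Gᶜ.val := fun j => by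
    rw [Finset.erase_val, Multiset.singleton_add]
    exact Multiset.cons_erase (by simpa using j.2)
  let φ : ContractiveForm H :=
    ⟨szegoSum T G, adjoint (weyl hs hT Gᶜ.val), hB G,
      szegoForm_adjoint_weyl_le hs hT hB _ hmem⟩
  obtain ⟨E, i1, i2, i3, ι, U, h1, h2, h3⟩ := φ.exists_unitary_model
    (J := {j // j ∉ G})
    (fun j => adjoint (weyl hs hT {(j : Fin n)}))
    -- The scalar is chosen so that `C_j B_j = A` exactly.
    (fun j => (bichar s (Gᶜ.erase j).val {(j : Fin n)} : ℂ) •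
      adjoint (weyl hs hT (Gᶜ.erase j).val))
    (fun j => (bichar s {(j : Fin n)} Gᶜ.val ^ 2)⁻¹)
    (fun j x => adjoint_weyl_comm hs hT _ _ x)
    (fun j x => by
      -- Since `σ(Gᶜ,Gᶜ) = 1`, the phases of `{j}` and of `Gᶜ \ {j}` against `Gᶜ` are mutually
      -- inverse.
      have h := congrArg (fun a => bichar s a Gᶜ.val) (hsplit j)
      simp only [bichar_add_left, hs.bichar_self] at h
      rw [smul_apply, smul_apply, map_smul, smul_comm]
      congr 1
      rw [inv_inv, eq_inv_of_mul_eq_one_left h, inv_pow]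
      exact adjoint_weyl_comm hs hT _ _ x)
    (fun j x => by
      rw [smul_apply, map_smul, adjoint_weyl_mul, add_comm, hsplit, smul_smul,
        Complex.mul_conj, Complex.normSq_eq_norm_sq, Circle.norm_coe]
      simp [φ])
    (fun j x => szegoForm_adjoint_weyl_le hs hT hB _ (fun i hi => by
      rw [Multiset.mem_singleton.1 hi]; exact j.2) x)
    (fun j x => by
      change szegoForm T G (adjoint (weyl hs hT Gᶜ.val) x)
        ≤ szegoForm T G (adjoint (weyl hs hT {(j : Fin n)}) x)
      rw [← hsplit j, ← szegoForm_adjoint_adjoint]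
      exact szegoForm_adjoint_weyl_le hs hT hB _
        (fun i hi => hmem i (Finset.mem_of_mem_erase hi)) _)
  refine ⟨E, i1, i2, i3, ι, U, fun x => (h1 x).congr fun N => ?_, fun j x => ?_, fun i j => ?_⟩
  · obtain ⟨c, hc⟩ := weyl_pow hs hT Gᶜ.val N
    change szegoForm T G ((adjoint (weyl hs hT Gᶜ.val) ^ N) x) = _
    rw [← star_eq_adjoint, ← star_pow, hc, star_eq_adjoint, map_smulₛₗ, smul_apply,
      ← Circle.coe_inv_eq_conj, szegoForm_smul]
  · rw [h2, weyl_singleton]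
  · refine h3 i j _ fun x => ?_
    rw [adjoint_weyl_comm, bichar_singleton, hs.sq, Circle.coe_inv_eq_conj]

end Model

/-! ## Operators on the Hardy space -/

section HardyOperators

variable {n : ℕ} {G : Finset (Fin n)} {E : Type*} [NormedAddCommGroup E] [InnerProductSpace ℂ E]

theorem bichar_multiIndex (s : Fin n → Fin n → Circle) (j : Fin n) (k : G → ℕ) :
    bichar s {j} (multiIndex k) = ∏ i : G, s j i ^ k i := by
  have h : ∀ (S : Finset G), bichar s {j} (∑ i ∈ S, k i • {(i : Fin n)}) = ∏ i ∈ S, s j i ^ k i := by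
    intro S
    induction S using Finset.induction with
    | empty => simp
    | insert i S hi ih =>
      rw [Finset.sum_insert hi, Finset.prod_insert hi, bichar_add_right, ih]
      congr 1
      induction k i with
      | zero => simp
      | succ m ih => rw [succ_nsmul, bichar_add_right, ih, bichar_singleton, pow_succ]
  exact h _

theorem rotationalShift_apply (s : Fin n → Fin n → Circle) (m : G) (f : Hardy G E) (k : G → ℕ) :
    rotationalShift s G m E f k = if k m = 0 then 0 else
      (bichar s {(m : Fin n)} (multiIndex (k - Pi.single m 1)) : ℂ) • f (k - Pi.single m 1) := by
  have h : ∀ l : G → ℕ, (bichar s {(m : Fin n)} (multiIndex l) : ℂ) = ∏ i : G, (s m i : ℂ) ^ l i :=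
    fun l => by
      rw [bichar_multiIndex]
      refine (map_prod Circle.coeHom (fun i : G => s m i ^ l i) Finset.univ).trans ?_
      exact Finset.prod_congr rfl fun i _ => map_pow Circle.coeHom _ _
  rw [h]
  rfl

theorem isometry_rotationalShift (s : Fin n → Fin n → Circle) (m : G) :
    Isometry (rotationalShift s G m E) := by
  have h1 : Isometry (Hardy.shift m : Hardy G E →L[ℂ] Hardy G E) := by
    rw [Hardy.shift, LinearIsometry.coe_toContinuousLinearMap]
    exact LinearIsometry.isometry _
  have h2 : Isometry (Hardy.rotation (fun i : G => s m i) : Hardy G E →L[ℂ] Hardy G E) := by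
    rw [Hardy.rotation, LinearIsometry.coe_toContinuousLinearMap]
    exact LinearIsometry.isometry _
  exact h1.comp h2

theorem rotationalShift_single (s : Fin n → Fin n → Circle) (m : G) (k : G → ℕ) (e : E) :
    rotationalShift s G m E (lp.single 2 k e) = lp.single 2 (k + Pi.single m 1)
      ((bichar s {(m : Fin n)} (multiIndex k) : ℂ) • e) := by
  ext k'
  rw [rotationalShift_apply, lp.coeFn_single, lp.coeFn_single]
  by_cases hk : k' ∈ Set.range fun k : G → ℕ => k + Pi.single m 1
  · obtain ⟨l, rfl⟩ := hk
    by_cases hl : l = k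
    · subst hl
      simp
    · have hl' : l + Pi.single m 1 ≠ k + Pi.single m 1 := fun h => hl (Hardy.shift_inj m h)
      rw [Pi.single_eq_of_ne hl']
      simp [hl]
  · rw [if_pos (Hardy.shift_support m k' hk), Pi.single_eq_of_ne]
    rintro rfl
    exact hk ⟨k, rfl⟩

/-- The diagonal unitary `f ↦ ∑ conj(c_k) (U a_k) z^k`. -/
def diagonalUnitary (c : (G → ℕ) → Circle) (U : E ≃ₗᵢ[ℂ] E) : Hardy G E ≃ₗᵢ[ℂ] Hardy G E where
  toFun f := ⟨fun k => conj (c k : ℂ) • U (f k), (Hardy.memℓp_iff _).2 (by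
    simpa [norm_smul, Circle.norm_coe] using f.summable_sq)⟩
  invFun f := ⟨fun k => (c k : ℂ) • U.symm (f k), (Hardy.memℓp_iff _).2 (by
    simpa [norm_smul, Circle.norm_coe] using f.summable_sq)⟩
  left_inv f := by
    ext k
    change (c k : ℂ) • U.symm (conj (c k : ℂ) • U (f k)) = f k
    rw [map_smul, U.symm_apply_apply, smul_smul, ← Circle.coe_inv_eq_conj, ← Circle.coe_mul]
    simp
  right_inv f := by
    ext k
    change conj (c k : ℂ) • U ((c k : ℂ) • U.symm (f k)) = f k
    rw [map_smul, U.apply_symm_apply, smul_smul, ← Circle.coe_inv_eq_conj, ← Circle.coe_mul]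
    simp
  map_add' f g := by
    ext k
    change conj (c k : ℂ) • U (f k + g k) = conj (c k : ℂ) • U (f k) + conj (c k : ℂ) • U (g k)
    rw [map_add, smul_add]
  map_smul' a f := by
    ext k
    change conj (c k : ℂ) • U (a • f k) = a • conj (c k : ℂ) • U (f k)
    rw [map_smul, smul_comm]
  norm_map' f := by
    rw [← sq_eq_sq₀ (norm_nonneg _) (norm_nonneg _), Hardy.norm_sq, Hardy.norm_sq]
    refine tsum_congr fun k => ?_
    change ‖conj (c k : ℂ) • U (f k)‖ ^ 2 = _
    simp [norm_smul, Circle.norm_coe]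

/-- The operators of the model of `G`: rotational shifts for `j ∈ G`, and diagonal unitaries for
`j ∉ G`. -/
def modelOp (q s : Fin n → Fin n → Circle) (G : Finset (Fin n)) (U : {j // j ∉ G} → E ≃ₗᵢ[ℂ] E)
    (j : Fin n) : Hardy G E →L[ℂ] Hardy G E :=
  if hj : j ∈ G then rotationalShift s G ⟨j, hj⟩ E
  -- The inverse is taken because `U` extends `T_j^*`: it is the adjoint of the model operator that
  -- must act through `U`.
  else ((diagonalUnitary (fun k : G → ℕ => bichar q {j} (multiIndex k)) (U ⟨j, hj⟩)).symm :
    Hardy G E →L[ℂ] Hardy G E)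

variable (q s : Fin n → Fin n → Circle) (U : {j // j ∉ G} → E ≃ₗᵢ[ℂ] E)

theorem modelOp_of_mem {j : Fin n} (hj : j ∈ G) :
    modelOp q s G U j = rotationalShift s G ⟨j, hj⟩ E := dif_pos hj

theorem modelOp_of_notMem {j : Fin n} (hj : j ∉ G) :
    modelOp q s G U j = ((diagonalUnitary (fun k : G → ℕ => bichar q {j} (multiIndex k))
      (U ⟨j, hj⟩)).symm : Hardy G E →L[ℂ] Hardy G E) := dif_neg hj

theorem isometry_modelOp (j : Fin n) : Isometry (modelOp q s G U j) := by
  by_cases hj : j ∈ G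
  · rw [modelOp_of_mem q s U hj]
    exact isometry_rotationalShift s _
  · rw [modelOp_of_notMem q s U hj]
    exact LinearIsometryEquiv.isometry _

variable [CompleteSpace E]

theorem adjoint_rotationalShift_apply (s : Fin n → Fin n → Circle) (m : G) (f : Hardy G E)
    (k : G → ℕ) : adjoint (rotationalShift s G m E) f k
      = conj (bichar s {(m : Fin n)} (multiIndex k) : ℂ) • f (k + Pi.single m 1) := by
  refine ext_inner_left ℂ fun e => ?_
  refine (lp.inner_single_left (𝕜 := ℂ) (G := fun _ : G → ℕ => E) k e
    (adjoint (rotationalShift s G m E) f)).symm.trans ?_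
  rw [adjoint_inner_right, rotationalShift_single, lp.inner_single_left,
    inner_smul_left]
  exact (inner_smul_right (𝕜 := ℂ) (E := E) _ _ _).symm

theorem adjoint_modelOp_apply_of_mem {j : Fin n} (hj : j ∈ G) (f : Hardy G E) (k : G → ℕ) :
    adjoint (modelOp q s G U j) f k
      = conj (bichar s {j} (multiIndex k) : ℂ) • f (k + Pi.single ⟨j, hj⟩ 1) := by
  rw [modelOp_of_mem q s U hj, adjoint_rotationalShift_apply]

theorem adjoint_modelOp_apply_of_notMem {j : Fin n} (hj : j ∉ G) (f : Hardy G E) (k : G → ℕ) :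
    adjoint (modelOp q s G U j) f k
      = conj (bichar q {j} (multiIndex k) : ℂ) • U ⟨j, hj⟩ (f k) := by
  rw [modelOp_of_notMem q s U hj, LinearIsometryEquiv.adjoint_eq_symm]
  rfl

theorem modelOp_mem_unitary {j : Fin n} (hj : j ∉ G) :
    modelOp q s G U j ∈ unitary (Hardy G E →L[ℂ] Hardy G E) := by
  rw [modelOp_of_notMem q s U hj, Unitary.mem_iff, star_eq_adjoint,
    LinearIsometryEquiv.adjoint_eq_symm]
  constructor <;> ext f : 1 <;> simp

variable {q s U}

theorem adjoint_modelOp_comm (hs : IsSqrtChoice q s)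
    (hU : ∀ (i j : {j // j ∉ G}) (x : E), U i (U j x) = conj (q j i : ℂ) • U j (U i x))
    (i j : Fin n) (f : Hardy G E) :
    adjoint (modelOp q s G U i) (adjoint (modelOp q s G U j) f)
      = conj (q j i : ℂ) • adjoint (modelOp q s G U j) (adjoint (modelOp q s G U i) f) := by
  -- Shifting `k` by `e_i` changes the diagonal phase `bichar q {j}` by exactly `q j i`.
  have key : ∀ i j, i ∈ G → j ∉ G → ∀ f : Hardy G E,
      adjoint (modelOp q s G U i) (adjoint (modelOp q s G U j) f)
      = conj (q j i : ℂ) • adjoint (modelOp q s G U j) (adjoint (modelOp q s G U i) f) := by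
    intro i j hi hj f
    ext k
    rw [lp.coeFn_smul, Pi.smul_apply, adjoint_modelOp_apply_of_mem _ _ _ hi,
      adjoint_modelOp_apply_of_notMem _ _ _ hj, adjoint_modelOp_apply_of_notMem _ _ _ hj,
      adjoint_modelOp_apply_of_mem _ _ _ hi, multiIndex_add_single, bichar_add_right,
      bichar_singleton, map_smul]
    simp only [smul_smul, ← map_mul]
    congr 2
    push_cast
    ring
  have hq : ∀ i j, conj (q i j : ℂ) * conj (q j i : ℂ) = 1 := fun i j => by
    rw [← hs.sq, ← hs.sq, hs.inv_symm i j, ← map_mul, ← Circle.coe_mul]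
    simp
  by_cases hi : i ∈ G <;> by_cases hj : j ∈ G
  · ext k
    rw [lp.coeFn_smul, Pi.smul_apply, adjoint_modelOp_apply_of_mem _ _ _ hi,
      adjoint_modelOp_apply_of_mem _ _ _ hj, adjoint_modelOp_apply_of_mem _ _ _ hj,
      adjoint_modelOp_apply_of_mem _ _ _ hi, multiIndex_add_single, multiIndex_add_single,
      bichar_add_right, bichar_add_right, bichar_singleton, bichar_singleton, add_right_comm,
      ← hs.sq, hs.inv_symm i j]
    simp only [smul_smul, ← map_mul, ← Circle.coe_mul]
    congr 3
    have h1 : ∀ x y z : Circle, x * (z * y) = z ^ 2 * (y * (z⁻¹ * x)) := fun x y z => by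
      rw [mul_left_comm y, sq, mul_assoc, mul_inv_cancel_left, mul_left_comm, mul_comm x y]
    exact h1 _ _ _
  · exact key i j hi hj f
  · rw [key j i hj hi, smul_smul, mul_comm, hq, one_smul]
  · ext k
    rw [lp.coeFn_smul, Pi.smul_apply, adjoint_modelOp_apply_of_notMem _ _ _ hi,
      adjoint_modelOp_apply_of_notMem _ _ _ hj, adjoint_modelOp_apply_of_notMem _ _ _ hj,
      adjoint_modelOp_apply_of_notMem _ _ _ hi, map_smul, map_smul, hU]
    simp only [smul_smul]
    congr 1
    ring

theorem isQCommuting_modelOp (hs : IsSqrtChoice q s)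
    (hU : ∀ (i j : {j // j ∉ G}) (x : E), U i (U j x) = conj (q j i : ℂ) • U j (U i x)) :
    IsQCommuting q (modelOp q s G U) := by
  intro i j
  apply (adjoint : (Hardy G E →L[ℂ] Hardy G E) ≃ₗᵢ⋆[ℂ] _).injective
  ext f : 1
  rw [map_smulₛₗ, adjoint_comp, adjoint_comp]
  exact adjoint_modelOp_comm hs hU j i f

/-- If the `j`-th operator is unitary, conjugating the `q`-commutation relation by its adjoint
suffices; if the `i`-th is, take adjoints. Two rotational shifts are compared on coefficients. -/
theorem isDoublyQCommuting_modelOp (hq : IsCommutationFactor q) (hs : IsSqrtChoice q s)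
    (hU : ∀ (i j : {j // j ∉ G}) (x : E), U i (U j x) = conj (q j i : ℂ) • U j (U i x)) :
    IsDoublyQCommuting q (modelOp q s G U) := by
  have hc := isQCommuting_modelOp hs hU
  have key : ∀ i j, j ∉ G → modelOp q s G U i ∘L adjoint (modelOp q s G U j)
      = conj (q i j : ℂ) • (adjoint (modelOp q s G U j) ∘L modelOp q s G U i) := by
    intro i j hj
    obtain ⟨h1, h2⟩ := Unitary.mem_iff.1 (modelOp_mem_unitary q s U hj)
    rw [star_eq_adjoint] at h1 h2
    set A := modelOp q s G U i
    set B := modelOp q s G U j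
    have h3 : A * B = (q i j : ℂ) • (B * A) := hc i j
    change A * adjoint B = conj (q i j : ℂ) • (adjoint B * A)
    calc A * adjoint B = (adjoint B * B) * (A * adjoint B) := by rw [h1, one_mul]
      _ = adjoint B * (B * A) * adjoint B := by simp only [mul_assoc]
      _ = adjoint B * (conj (q i j : ℂ) • (A * B)) * adjoint B := by
          rw [h3, smul_smul, ← Circle.coe_inv_eq_conj, ← Circle.coe_mul, inv_mul_cancel,
            Circle.coe_one, one_smul]
      _ = conj (q i j : ℂ) • (adjoint B * A * (B * adjoint B)) := by
          rw [mul_smul_comm, smul_mul_assoc]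
          simp only [mul_assoc]
      _ = _ := by rw [h2, mul_one]
  refine ⟨hc, fun i j hij => ?_⟩
  by_cases hj : j ∈ G
  swap
  · exact key i j hj
  by_cases hi : i ∈ G
  · ext f k
    rw [smul_apply, lp.coeFn_smul, Pi.smul_apply, comp_apply, comp_apply,
      adjoint_modelOp_apply_of_mem _ _ _ hj, modelOp_of_mem q s U hi, rotationalShift_apply,
      rotationalShift_apply]
    have hij' : (⟨i, hi⟩ : G) ≠ ⟨j, hj⟩ := fun h => hij (congrArg Subtype.val h)
    by_cases hk : k ∈ Set.range fun k : G → ℕ => k + Pi.single ⟨i, hi⟩ 1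
    · obtain ⟨l, rfl⟩ := hk
      simp only
      rw [if_neg (by simp), if_neg (by simp), add_right_comm, add_tsub_cancel_right,
        add_tsub_cancel_right, adjoint_modelOp_apply_of_mem _ _ _ hj, multiIndex_add_single,
        multiIndex_add_single, bichar_add_right, bichar_add_right, bichar_singleton,
        bichar_singleton, ← hs.sq, hs.inv_symm j i]
      simp only [smul_smul, ← Circle.coe_inv_eq_conj, ← Circle.coe_mul]
      congr 2
      have h1 : ∀ x y z : Circle, x * y⁻¹ = (z ^ 2)⁻¹ * ((z⁻¹ * y)⁻¹ * (z * x)) :=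
        fun x y z => by
          rw [mul_inv, inv_inv, mul_comm z y⁻¹, mul_assoc, ← mul_assoc z z, ← sq,
            mul_left_comm, mul_comm x, inv_mul_cancel_left]
      exact h1 _ _ _
    -- Here `k i = 0`, and adding `e_j` with `j ≠ i` keeps it so: both sides vanish.
    · have h0 := Hardy.shift_support _ k hk
      have h1 : (k + Pi.single ⟨j, hj⟩ 1 : G → ℕ) ⟨i, hi⟩ = 0 := by
        rw [Pi.add_apply, h0, Pi.single_eq_of_ne hij', add_zero]
      rw [if_pos h0, if_pos h1, smul_zero]
      exact (smul_zero _).symm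
  · have h1 := congrArg (adjoint : (Hardy G E →L[ℂ] Hardy G E) ≃ₗᵢ⋆[ℂ] _) (key j i hi)
    rw [map_smulₛₗ, adjoint_comp, adjoint_comp, adjoint_adjoint] at h1
    rw [h1, ← hq.conj_symm]

end HardyOperators

/-! ## The dilation -/

section Dilation

variable {n : ℕ} {q s : Fin n → Fin n → Circle} {H : Type*} [NormedAddCommGroup H]
  [InnerProductSpace ℂ H] [CompleteSpace H] {T : Fin n → H →L[ℂ] H}
  {E : Finset (Fin n) → Type*} [∀ G, NormedAddCommGroup (E G)] [∀ G, InnerProductSpace ℂ (E G)]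

theorem exists_dilation_isometry (hs : IsSqrtChoice q s) (hT : IsBrehmerTuple q T)
    (ι : ∀ G, H →ₗ[ℂ] E G)
    (hι : ∀ G x, Tendsto (fun N : ℕ => szegoForm T G (adjoint (weyl hs hT.qcomm (N • Gᶜ.val)) x))
      atTop (𝓝 (‖ι G x‖ ^ 2))) :
    ∃ Φ : H →ₗᵢ[ℂ] PiLp 2 fun G : Finset (Fin n) => Hardy G (E G),
      ∀ h G k, Φ h G k = ι G (adjoint (weyl hs hT.qcomm (multiIndex k)) h) := by
  have hsum := fun h => sum_tsum_eq_norm_sq hs hT.qcomm hT.brehmer (fun G x => ‖ι G x‖ ^ 2) hι h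
  let φ : H → ∀ G : Finset (Fin n), Hardy G (E G) := fun h G =>
    ⟨fun k => ι G (adjoint (weyl hs hT.qcomm (multiIndex k)) h),
      (Hardy.memℓp_iff _).2 ((hsum h).1 G)⟩
  refine ⟨⟨⟨⟨fun h => WithLp.toLp 2 (φ h), fun x y => ?_⟩, fun a x => ?_⟩, fun h => ?_⟩,
    fun h G k => rfl⟩
  · ext G k
    change ι G (adjoint _ (x + y)) = ι G (adjoint _ x) + ι G (adjoint _ y)
    rw [map_add, map_add]
  · ext G k
    change ι G (adjoint _ (a • x)) = a • ι G (adjoint _ x)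
    rw [map_smul, map_smul]
  · change ‖WithLp.toLp 2 (φ h)‖ = ‖h‖
    rw [← sq_eq_sq₀ (norm_nonneg _) (norm_nonneg _), PiLp.norm_sq_eq_of_L2, ← (hsum h).2]
    exact Finset.sum_congr rfl fun G _ => Hardy.norm_sq _

/-- For `j ∈ G`, merging `T^{(k)*} T_j^*` into one monomial produces the very phase of the
rotational shift. For `j ∉ G`, moving `T_j^*` to the left past `T^{(k)*}` produces the diagonal
phase, and `ι` turns `T_j^*` into `U`. -/
theorem dilation_intertwines [∀ G, CompleteSpace (E G)] (hs : IsSqrtChoice q s)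
    (hT : IsQCommuting q T) (ι : ∀ G, H →ₗ[ℂ] E G)
    (U : ∀ G, {j // j ∉ G} → E G ≃ₗᵢ[ℂ] E G)
    (hU : ∀ G j x, U G j (ι G x) = ι G (adjoint (T j) x))
    (Φ : H →ₗᵢ[ℂ] PiLp 2 fun G : Finset (Fin n) => Hardy G (E G))
    (hΦ : ∀ h G k, Φ h G k = ι G (adjoint (weyl hs hT (multiIndex k)) h)) (j : Fin n) :
    Φ.toContinuousLinearMap ∘L adjoint (T j) =
      directSumOp (fun G => adjoint (modelOp q s G (U G) j)) ∘L Φ.toContinuousLinearMap := by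
  ext h G k
  change Φ (adjoint (T j) h) G k = adjoint (modelOp q s G (U G) j) (Φ h G) k
  rw [hΦ, ← weyl_singleton hs hT j]
  by_cases hj : j ∈ G
  · rw [adjoint_modelOp_apply_of_mem _ _ _ hj, hΦ, adjoint_weyl_mul, map_smul,
      multiIndex_add_single]
  · have h1 : bichar q {j} (multiIndex k) = bichar s {j} (multiIndex k) ^ 2 := by
      rw [bichar_multiIndex, bichar_multiIndex, ← Finset.prod_pow]
      exact Finset.prod_congr rfl fun i _ => by rw [← hs.sq, ← pow_mul, ← pow_mul, mul_comm]
    rw [adjoint_modelOp_apply_of_notMem _ _ _ hj, hΦ, hU, adjoint_weyl_comm, map_smul,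
      weyl_singleton, h1, Circle.coe_inv_eq_conj]

end Dilation

end QComm

end

theorem mainTheorem2 {n : ℕ} (q : Fin n → Fin n → Circle) (hq : QComm.IsCommutationFactor q)
    (s : Fin n → Fin n → Circle) (hs : QComm.IsSqrtChoice q s)
    {H : Type u} [NormedAddCommGroup H] [InnerProductSpace ℂ H] [CompleteSpace H]
    (T : Fin n → H →L[ℂ] H) (hT : QComm.IsBrehmerTuple q T) :
    ∃ (E : Finset (Fin n) → Type u) (_ : ∀ G, NormedAddCommGroup (E G))
      (_ : ∀ G, InnerProductSpace ℂ (E G)) (_ : ∀ G, CompleteSpace (E G))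
      (V : ∀ G : Finset (Fin n), Fin n → QComm.Hardy G (E G) →L[ℂ] QComm.Hardy G (E G))
      (Φ : H →ₗᵢ[ℂ] PiLp 2 fun G : Finset (Fin n) => QComm.Hardy G (E G)),
      (∀ G j, Isometry (V G j)) ∧
      (∀ G, QComm.IsDoublyQCommuting q (V G)) ∧
      (∀ j, Φ.toContinuousLinearMap ∘L ContinuousLinearMap.adjoint (T j) =
        QComm.directSumOp (fun G => ContinuousLinearMap.adjoint (V G j)) ∘L
          Φ.toContinuousLinearMap) ∧
      (∀ (G : Finset (Fin n)) (i : Fin n) (hi : i ∈ G),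
        V G i = QComm.rotationalShift s G ⟨i, hi⟩ (E G)) ∧
      (∀ (G : Finset (Fin n)) (j : Fin n), j ∉ G →
        V G j ∈ unitary (QComm.Hardy G (E G) →L[ℂ] QComm.Hardy G (E G))) := by
  choose E i1 i2 i3 ι U hι hU hUU using QComm.exists_szegoForm_model hs hT.qcomm hT.brehmer
  obtain ⟨Φ, hΦ⟩ := QComm.exists_dilation_isometry hs hT ι hι
  exact ⟨E, i1, i2, i3, fun G => QComm.modelOp q s G (U G), Φ,
    fun G j => QComm.isometry_modelOp q s (U G) j,
    fun G => QComm.isDoublyQCommuting_modelOp hq hs (hUU G),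
    QComm.dilation_intertwines hs hT.qcomm ι U hU Φ hΦ,
    fun G i hi => QComm.modelOp_of_mem q s (U G) hi,
    fun G j hj => QComm.modelOp_mem_unitary q s (U G) hj⟩
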